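/- All graphs are finite and simple; $e(G)$ is the number of edges of $G$, and $T_r(m)$ is the Turán graph, i.e. the $m$-vertex complete $r$-partite graph with parts as balanced as possible. A graph is traceable if it contains a Hamiltonian path. A graph is $k$-path Hamiltonian if every path of length at most $k$ in it (a single vertex being a path of length $0$) is contained in a Hamiltonian cycle. Let $\mathcal J^k_{n,r}$ be the set of $n$-vertex, $K_{r+1}$-free graphs consisting of $T_r(n-1)$ plus one vertex of degree $k+1$ whose neighbourhood induces a traceable graph. Let $r\ge 3$ and $k\ge 0$ be integers and let $G$ be an $n$-vertex, $K_{r+1}$-free graph. (1) Suppose that $n\ge 6k+26$ if $r=3$, $n\ge 5k+11$ if $4\le r\le 7$, and $n\ge 2k+9$ if $r\ge 8$. If $G$ is not $k$-path Hamiltonian, then $$e(G)\le e(T_r(n-1))+k+1 .$$ If $G\in\mathcal J^k_{n,r}$, then $G$ is not $k$-path Hamiltonian and equality holds. (2) Suppose that $n\ge 6k+26$ if $r=3$, $n\ge 6k+2r+3$ if $4\le r\le 7$, and $n\ge 2k+2r$ if $r\ge 8$. If $G$ is not $k$-path Hamiltonian, then $e(G)\le e(T_r(n-1))+k+1$. Moreover,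 $G$ is not $k$-path Hamiltonian and satisfies $e(G)=e(T_r(n-1))+k+1$ if and only if $G\in\mathcal J^k_{n,r}$, or $(k,r,n)=(0,4,11)$ and $G\cong K_{6,2,2,1}$. -/

import Mathlib

namespace SimpleGraph

/-- A graph is traceable if it contains a Hamiltonian path. -/
def Traceable {V : Type*} [DecidableEq V] (G : SimpleGraph V) : Prop :=
  ∃ (a b : V) (p : G.Walk a b), p.IsHamiltonian

/-- A graph is `k`-path Hamiltonian if every path of length at most `k` is contained
(as a subgraph) in a Hamiltonian cycle. -/
def IsPathHamiltonian {V : Type*} [DecidableEq V] (G : SimpleGraph V) (k : ℕ) : Prop :=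
  ∀ (u v : V) (p : G.Walk u v), p.IsPath → p.length ≤ k →
    ∃ (a : V) (c : G.Walk a a), c.IsHamiltonianCycle ∧ p.toSubgraph ≤ c.toSubgraph

/-- Membership in the family of `n`-vertex, `K_{r+1}`-free graphs consisting of the Turán graph
`T_r(n-1)` plus one vertex of degree `k+1` whose neighbourhood induces a traceable graph. -/
def IsTuranPlusTraceableVertex {V : Type*} [Fintype V] [DecidableEq V] (G : SimpleGraph V)
    [DecidableRel G.Adj] (n r k : ℕ) : Prop :=
  Fintype.card V = n ∧ G.CliqueFree (r + 1) ∧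
    ∃ v : V, Nonempty (G.induce ({v}ᶜ : Set V) ≃g turanGraph (n - 1) r) ∧
      G.degree v = k + 1 ∧ (G.induce (G.neighborSet v)).Traceable

/-- The complete multipartite graph `K_{6,2,2,1}`. -/
abbrev K6221 : SimpleGraph (Σ i : Fin 4, Fin (![6, 2, 2, 1] i)) :=
  completeMultipartiteGraph fun i : Fin 4 => Fin (![6, 2, 2, 1] i)

end SimpleGraph

/-!
A path of length at most `k` that lies in no Hamiltonian cycle can be kept so while edges are added
until any two nonadjacent vertices have degree sum less than `n + k`. Chvátal's argument then gives
an `i` with `2 * i < n + k` and `s = i - k` vertices of degree at most `i`. Deleting these leaves a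
`K_{r+1}`-free graph, so `e(G) ≤ e(T_r(n-s)) + s * (s + k)`, which is less than
`e(T_r(n-1)) + k + 1` once `s ≥ 2`, with two exceptions. If `r = 3` and `s` is at least about
`2 * n / 5`, a weighted Turán inequality of Motzkin and Straus replaces Turán's theorem. If `r = 4`,
`n = 5 * k + 11` and `s = 2 * k + 5`, the same `i` yields one further vertex of small degree, and
equality forces `K_{6,2,2,1}`.

If `s ≤ 1`, some vertex `u` has degree at most `k + 1`, and equality makes `G - u` a Turán graph.
In the edge-maximal supergraph the vertices other than `u` are then pairwise adjacent, and the only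
obstruction to extending the path is that its vertices are exactly the neighbours of `u`.
-/

namespace PathHamiltonian

open SimpleGraph Finset

section TuranNumbers

lemma card_edgeFinset_turanGraph_of_le {m r : ℕ} (h : m ≤ r) :
    #(turanGraph m r).edgeFinset = m.choose 2 := by
  rw [edgeFinset_inj.2 (turanGraph_eq_top.2 (Or.inr h)), card_edgeFinset_top_eq_card_choose_two,
    Fintype.card_fin]

lemma card_edgeFinset_turanGraph_succ {r : ℕ} (hr : 0 < r) (m : ℕ) :
    #(turanGraph (m + 1) r).edgeFinset + m / r = #(turanGraph m r).edgeFinset + m := by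
  induction m using Nat.strong_induction_on with
  | _ m ih =>
    rcases lt_or_ge m r with hm | hm
    · rw [card_edgeFinset_turanGraph_of_le hm, card_edgeFinset_turanGraph_of_le hm.le,
        Nat.div_eq_of_lt hm, show (m + 1).choose 2 = m.choose 1 + m.choose 2 from rfl,
        Nat.choose_one_right]
      omega
    · obtain ⟨m, rfl⟩ := Nat.exists_eq_add_of_le' hm
      obtain ⟨r, rfl⟩ := Nat.exists_eq_add_of_le' hr
      have h := ih m (by omega)
      rw [add_right_comm m, card_edgeFinset_turanGraph_add, card_edgeFinset_turanGraph_add,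
        Nat.add_div_right _ hr, add_tsub_cancel_right]
      linarith

lemma mul_sq_le_card_edgeFinset_turanGraph {r : ℕ} (hr : 0 < r) (m : ℕ) :
    4 * ((r : ℤ) - 1) * m ^ 2 ≤ 8 * r * #(turanGraph m r).edgeFinset + r ^ 2 := by
  have two_mul_choose_two (n : ℕ) : 2 * (n.choose 2 : ℤ) = n * (n - 1) := by
    have h : 2 * (n.choose 2 : ℚ) = n * (n - 1) := by rw [Nat.cast_choose_two]; ring
    exact_mod_cast h
  induction m using Nat.strong_induction_on with
  | _ m ih =>
    rcases lt_or_ge m r with hm | hm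
    · rw [card_edgeFinset_turanGraph_of_le hm.le]
      nlinarith [sq_nonneg ((2 : ℤ) * m - r), two_mul_choose_two m]
    · obtain ⟨m, rfl⟩ := Nat.exists_eq_add_of_le' hm
      rw [card_edgeFinset_turanGraph_add]
      push_cast [Nat.cast_sub hr]
      linear_combination ih m (by omega) - 4 * (r : ℤ) * two_mul_choose_two r

lemma mul_sub_le_card_edgeFinset_turanGraph_sub {c r : ℕ} (hc : 0 < c) (hcr : c ≤ r) (b d : ℕ) :
    ((c : ℤ) - 1) * ((b + d) * (b + d - 1) - b * (b - 1)) ≤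
      2 * c * (#(turanGraph (b + d) r).edgeFinset - #(turanGraph b r).edgeFinset) := by
  induction d with
  | zero => simp
  | succ d ih =>
    have hsucc := card_edgeFinset_turanGraph_succ (hc.trans_le hcr) (b + d)
    have hdiv : c * ((b + d) / r) ≤ b + d :=
      (Nat.mul_le_mul_right _ hcr).trans (Nat.mul_div_le _ _)
    rw [← add_assoc]
    zify at hsucc hdiv
    push_cast at *
    nlinarith

lemma card_edgeFinset_turanGraph_three_add_mul_lt {n k s : ℕ} (hn : 6 * k + 26 ≤ n)
    (hs : 2 ≤ s) (hsn : 5 * s + 3 * k < 2 * n) :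
    #(turanGraph (n - s) 3).edgeFinset + s * (s + k) <
      #(turanGraph (n - 1) 3).edgeFinset + (k + 1) := by
  obtain ⟨d, rfl⟩ : ∃ d, s = d + 1 := ⟨s - 1, by omega⟩
  obtain ⟨b, rfl⟩ : ∃ b, n = b + d + 1 := ⟨n - (d + 1), by omega⟩
  rw [show b + d + 1 - (d + 1) = b by omega, add_tsub_cancel_right]
  have hincr := mul_sub_le_card_edgeFinset_turanGraph_sub (c := 3) (by norm_num) le_rfl b d
  have hd : (1 : ℤ) ≤ d := by omega
  have hslack : (1 : ℤ) ≤ 2 * b - 2 * d - 3 * k - 7 := by omega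
  zify
  push_cast at hincr
  nlinarith [mul_le_mul hd hslack (by norm_num) (by omega)]

lemma card_edgeFinset_turanGraph_four_add_mul_lt {n k s : ℕ} (hn : 5 * k + 11 ≤ n)
    (hs : 2 ≤ s) (hsn : 2 * s + k + 1 ≤ n) (hex : ¬ (n = 5 * k + 11 ∧ s = 2 * k + 5)) :
    #(turanGraph (n - s) 4).edgeFinset + s * (s + k) <
      #(turanGraph (n - 1) 4).edgeFinset + (k + 1) := by
  obtain ⟨d, rfl⟩ : ∃ d, s = d + 1 := ⟨s - 1, by omega⟩
  obtain ⟨b, rfl⟩ : ∃ b, n = b + d + 1 := ⟨n - (d + 1), by omega⟩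
  rw [show b + d + 1 - (d + 1) = b by omega, add_tsub_cancel_right]
  have hupper := mul_card_edgeFinset_turanGraph_le (n := b) (r := 4)
  have hlower := mul_sq_le_card_edgeFinset_turanGraph four_pos (b + d)
  have hd : (1 : ℤ) ≤ d := by omega
  have hslack : (d ≤ 4 ∧ (5 : ℤ) ≤ 6 * b - 5 * d - 8 * k - 16) ∨
      (5 : ℤ) ≤ d ∧ (1 : ℤ) ≤ 6 * b - 5 * d - 8 * k - 16 := by omega
  zify at hupper hlower ⊢
  push_cast at hupper hlower
  rcases hslack with ⟨-, hx⟩ | ⟨hd5, hx⟩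
  · nlinarith [mul_le_mul hd hx (by norm_num) (by omega)]
  · nlinarith [mul_le_mul hd5 hx (by norm_num) (by omega)]

lemma card_edgeFinset_turanGraph_add_mul_lt_of_five_le {n r k s : ℕ} (hr : 5 ≤ r)
    (hn : (if r ≤ 7 then 5 * k + 11 else 2 * k + 9) ≤ n) (hs : 2 ≤ s)
    (hsn : 2 * s + k + 1 ≤ n) :
    #(turanGraph (n - s) r).edgeFinset + s * (s + k) <
      #(turanGraph (n - 1) r).edgeFinset + (k + 1) := by
  obtain ⟨d, rfl⟩ : ∃ d, s = d + 1 := ⟨s - 1, by omega⟩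
  obtain ⟨b, rfl⟩ : ∃ b, n = b + d + 1 := ⟨n - (d + 1), by omega⟩
  rw [show b + d + 1 - (d + 1) = b by omega, add_tsub_cancel_right]
  have hd : (1 : ℤ) ≤ d := by omega
  split_ifs at hn with h7
  · -- The averaged increment bound below fails to give strictness only for these values.
    by_cases hsmall : b = 6 ∧ d = 4 ∧ k = 0
    · obtain ⟨rfl, rfl, rfl⟩ := hsmall
      have hstep (m : ℕ) (hm : m < 2 * r) :
          #(turanGraph m r).edgeFinset + m ≤ #(turanGraph (m + 1) r).edgeFinset + 1 := by
        have hdiv : m / r < 2 := Nat.div_lt_of_lt_mul (by omega)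
        have hsucc := card_edgeFinset_turanGraph_succ (by omega : 0 < r) m
        omega
      linarith [hstep 6 (by omega), hstep 7 (by omega), hstep 8 (by omega), hstep 9 (by omega)]
    have hincr := mul_sub_le_card_edgeFinset_turanGraph_sub (c := 5) (by norm_num) hr b d
    have hslack : (1 : ℤ) ≤ 8 * b - 6 * d - 10 * k - 24 := by omega
    zify
    push_cast at hincr
    nlinarith [mul_le_mul hd hslack (by norm_num) (by omega)]
  · have hincr := mul_sub_le_card_edgeFinset_turanGraph_sub (c := 8) (by norm_num)
      (by omega : 8 ≤ r) b d
    have hslack : (1 : ℤ) ≤ 14 * b - 9 * d - 16 * k - 39 := by omega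
    zify
    push_cast at hincr
    nlinarith [mul_le_mul hd hslack (by norm_num) (by omega)]

lemma four_mul_mul_lt_card_edgeFinset_turanGraph_three {n k i : ℕ} (hn : 6 * k + 26 ≤ n)
    (hi : 2 * i + 1 ≤ n + k) :
    4 * n * i < 4 * (#(turanGraph (n - 1) 3).edgeFinset + (k + 1)) + 3 * i ^ 2 := by
  obtain ⟨m, rfl⟩ : ∃ m, n = m + 1 := ⟨n - 1, by omega⟩
  have hlower := mul_sq_le_card_edgeFinset_turanGraph three_pos m
  rw [add_tsub_cancel_right]
  zify at *
  have hi' : (0 : ℤ) ≤ m + k - 2 * i := by linarith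
  nlinarith [mul_nonneg hi' (by linarith : (0 : ℤ) ≤ 5 * m - 3 * k - 6 * i + 8),
    mul_nonneg (Nat.cast_nonneg (α := ℤ) m) (by linarith : (0 : ℤ) ≤ m + 1 - 6 * k - 26)]

end TuranNumbers

section HamiltonianCyclesThroughEdges

variable {V : Type*} {H : SimpleGraph V} {a u v x y : V}

lemma isSubwalk_toWalk_getVert {p : H.Walk u v} {j : ℕ} (hj : j < p.length) :
    (p.adj_getVert_succ hj).toWalk.IsSubwalk p := by
  rw [Walk.isSubwalk_toWalk_iff_mem_darts]
  have hj' : j < p.darts.length := by rwa [Walk.length_darts]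
  convert List.getElem_mem hj' using 1
  ext <;> grind [Walk.fst_darts_getElem, Walk.snd_darts_getElem, Walk.support_getElem_eq_getVert]

lemma edge_mem_edgeSet_of_sup_edge {e : Sym2 V} (he : e ∈ (H ⊔ edge u v).edgeSet)
    (hne : e ≠ s(u, v)) : e ∈ H.edgeSet := by
  rw [edgeSet_sup] at he
  exact he.resolve_right fun h ↦ hne (edgeSet_edge_subset h)

variable [DecidableEq V]

lemma isHamiltonian_reverse {q : H.Walk x y} (hq : q.IsHamiltonian) : q.reverse.IsHamiltonian :=
  fun z ↦ by rw [Walk.support_reverse, List.count_reverse, hq z]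

lemma exists_isHamiltonian_of_isSubwalk {c : H.Walk a a} (hc : c.IsHamiltonianCycle)
    (h : H.Adj u v) (hsub : h.toWalk.IsSubwalk c) :
    ∃ q : H.Walk v u, q.IsHamiltonian ∧ c.edges.Perm (s(u, v) :: q.edges) := by
  obtain ⟨p₁, p₂, rfl⟩ := hsub
  refine ⟨p₂.append p₁, fun z ↦ ?_, ?_⟩
  · have hcount := (Walk.isHamiltonianCycle_iff_isCycle_and_support_count_tail_eq_one.1 hc).2 z
    rw [Walk.support_append, ← Walk.cons_tail_support p₂]
    rw [Walk.support_append, Walk.support_append, ← Walk.cons_tail_support p₁] at hcount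
    simp only [Walk.support_cons, Walk.support_nil, List.tail_cons, List.cons_append,
      List.count_append, List.count_cons, List.count_nil] at hcount ⊢
    omega
  · simp only [Walk.edges_append, Walk.edges_cons, Walk.edges_nil]
    grind

lemma exists_isHamiltonian_of_mem_edges {c : H.Walk a a} (hc : c.IsHamiltonianCycle)
    (h : s(u, v) ∈ c.edges) :
    ∃ p : H.Walk u v, p.IsHamiltonian ∧ c.edges.Perm (s(u, v) :: p.edges) := by
  have hadj := c.adj_of_mem_edges h
  rcases (Walk.isSubwalk_toWalk_iff_mem_edges hadj).2 h with hsub | hsub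
  · obtain ⟨q, hq, hperm⟩ := exists_isHamiltonian_of_isSubwalk hc hadj hsub
    refine ⟨q.reverse, isHamiltonian_reverse hq, hperm.trans ?_⟩
    simpa only [Walk.edges_reverse] using (List.reverse_perm _).symm.cons _
  · obtain ⟨q, hq, hperm⟩ := exists_isHamiltonian_of_isSubwalk hc hadj.symm hsub
    exact ⟨q, hq, Sym2.eq_swap ▸ hperm⟩

/-- `H` has a Hamiltonian cycle that uses all the edges in `F`. With `F` the edge set of a path
of length at most `k`, this is what `k`-path Hamiltonicity asks for. -/
def HasHamiltonianCycleThrough (H : SimpleGraph V) (F : Finset (Sym2 V)) : Prop :=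
  ∃ (a : V) (c : H.Walk a a), c.IsHamiltonianCycle ∧ ∀ e ∈ F, e ∈ c.edges

variable {F : Finset (Sym2 V)}

lemma exists_isHamiltonian_of_sup_edge [Finite V] (hF : ↑F ⊆ H.edgeSet)
    (hH : ¬ HasHamiltonianCycleThrough H F) (huv : ¬ H.Adj u v)
    (h : HasHamiltonianCycleThrough (H ⊔ edge u v) F) :
    ∃ p : H.Walk u v, p.IsHamiltonian ∧ ∀ e ∈ F, e ∈ p.edges := by
  cases nonempty_fintype V
  obtain ⟨a, c, hc, hcF⟩ := h
  have hmem : s(u, v) ∈ c.edges := by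
    by_contra hmem
    refine hH ⟨a, c.transfer H fun e he ↦ edge_mem_edgeSet_of_sup_edge
      (c.edges_subset_edgeSet he) (ne_of_mem_of_not_mem he hmem), ?_, by simpa using hcF⟩
    rw [Walk.isHamiltonianCycle_iff_isCycle_and_length_eq, Walk.length_transfer]
    exact ⟨hc.isCycle.transfer _, hc.length_eq⟩
  obtain ⟨p, hp, hperm⟩ := exists_isHamiltonian_of_mem_edges hc hmem
  have hnotMem : s(u, v) ∉ p.edges :=
    (List.nodup_cons.1 (hperm.nodup_iff.1 hc.isCycle.edges_nodup)).1
  refine ⟨p.transfer H fun e he ↦ edge_mem_edgeSet_of_sup_edge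
    (p.edges_subset_edgeSet he) (ne_of_mem_of_not_mem he hnotMem), ?_, fun e he ↦ ?_⟩
  · rw [Walk.isHamiltonian_iff_isPath_and_length_eq, Walk.length_transfer]
    exact ⟨hp.isPath.transfer _, hp.length_eq⟩
  · rw [Walk.edges_transfer]
    refine (List.mem_cons.1 (hperm.mem_iff.1 (hcF e he))).resolve_left ?_
    rintro rfl
    exact huv (hF he)

variable [Fintype V]

lemma isHamiltonianCycle_cons_of_isHamiltonian {q : H.Walk x y} (hq : q.IsHamiltonian)
    (h : H.Adj y x) (hV : 3 ≤ Fintype.card V) : (Walk.cons h q).IsHamiltonianCycle := by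
  rw [Walk.isHamiltonianCycle_iff_isCycle_and_length_eq, Walk.cons_isCycle_iff, Walk.length_cons]
  have hlen := hq.length_eq
  refine ⟨⟨hq.isPath, fun he ↦ ?_⟩, by omega⟩
  have := hq.isPath.length_eq_one_of_mem_edges (Sym2.eq_swap ▸ he)
  omega

lemma card_filter_adj_getVert_succ [DecidableRel H.Adj] {p : H.Walk u v} (hp : p.IsHamiltonian) :
    #{j ∈ range p.length | H.Adj u (p.getVert (j + 1))} = H.degree u := by
  rw [← card_neighborFinset_eq_degree]
  refine card_bij (fun j _ ↦ p.getVert (j + 1)) (by simp) (fun i hi j hj e ↦ ?_) fun w hw ↦ ?_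
  · simp only [mem_filter, mem_range] at hi hj
    exact Nat.succ_injective (hp.isPath.getVert_injOn hi.1 hj.1 e)
  · obtain ⟨i, rfl, hi⟩ := Walk.mem_support_iff_exists_getVert.1 (hp.mem_support w)
    rw [mem_neighborFinset] at hw
    cases i with
    | zero => simp at hw
    | succ i => exact ⟨i, by simpa using ⟨hi, hw⟩, rfl⟩

lemma card_filter_adj_getVert [DecidableRel H.Adj] {p : H.Walk u v} (hp : p.IsHamiltonian) :
    #{j ∈ range p.length | H.Adj v (p.getVert j)} = H.degree v := by
  rw [← card_neighborFinset_eq_degree]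
  refine card_bij (fun j _ ↦ p.getVert j) (by simp) (fun i hi j hj e ↦ ?_) fun w hw ↦ ?_
  · simp only [mem_filter, mem_range] at hi hj
    exact hp.isPath.getVert_injOn hi.1.le hj.1.le e
  · obtain ⟨i, rfl, hi⟩ := Walk.mem_support_iff_exists_getVert.1 (hp.mem_support w)
    rw [mem_neighborFinset] at hw
    rcases hi.lt_or_eq with hi | rfl
    · exact ⟨i, by simpa using ⟨hi, hw⟩, rfl⟩
    · simp at hw

lemma hasHamiltonianCycleThrough_of_exchange {p : H.Walk u v} (hp : p.IsHamiltonian)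
    (hF : ∀ e ∈ F, e ∈ p.edges) (hV : 3 ≤ Fintype.card V) (h : H.Adj x y)
    (hsub : h.toWalk.IsSubwalk p) (hxy : s(x, y) ∉ F) (huy : H.Adj u y) (hvx : H.Adj v x) :
    HasHamiltonianCycleThrough H F := by
  obtain ⟨p₁, p₂, rfl⟩ := hsub
  have hq : (p₁.append (Walk.cons hvx.symm p₂.reverse)).IsHamiltonian := fun z ↦ by
    simpa [Walk.support_append] using hp z
  refine ⟨_, Walk.cons huy.symm _, isHamiltonianCycle_cons_of_isHamiltonian hq _ hV,
    fun e he ↦ ?_⟩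
  have hne : e ≠ s(x, y) := ne_of_mem_of_not_mem he hxy
  have hmem := hF e he
  simp only [Walk.edges_cons, Walk.edges_append, Walk.edges_reverse, Walk.edges_nil,
    List.mem_cons, List.mem_append, List.mem_reverse] at hmem ⊢
  tauto

lemma degree_add_degree_le_of_isHamiltonian [DecidableRel H.Adj] {p : H.Walk u v}
    (hp : p.IsHamiltonian) (hF : ∀ e ∈ F, e ∈ p.edges) (hH : ¬ HasHamiltonianCycleThrough H F)
    (hV : 3 ≤ Fintype.card V) :
    H.degree u + H.degree v + 1 ≤ Fintype.card V + #F := by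
  set I := {j ∈ range p.length | H.Adj u (p.getVert (j + 1))}
  set J := {j ∈ range p.length | H.Adj v (p.getVert j)}
  have hunion : #(I ∪ J) ≤ p.length := by
    rw [← card_range p.length]
    exact card_le_card (union_subset (filter_subset _ _) (filter_subset _ _))
  have hinter : #(I ∩ J) ≤ #F := by
    have hlt {j : ℕ} (hj : j ∈ I ∩ J) : j < p.length :=
      mem_range.1 (mem_filter.1 (mem_inter.1 hj).1).1
    refine card_le_card_of_injOn (fun j ↦ s(p.getVert j, p.getVert (j + 1))) (fun j hj ↦ ?_)
      fun i hi j hj e ↦ ?_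
    · obtain ⟨hjI, hjJ⟩ := mem_inter.1 hj
      by_contra hjF
      exact hH (hasHamiltonianCycleThrough_of_exchange hp hF hV _
        (isSubwalk_toWalk_getVert (hlt hj)) hjF (mem_filter.1 hjI).2 (mem_filter.1 hjJ).2)
    · have hi := hlt hi
      have hj := hlt hj
      rcases Sym2.eq_iff.1 e with ⟨e, -⟩ | ⟨e, e'⟩
      · exact hp.isPath.getVert_injOn hi.le hj.le e
      · have := hp.isPath.getVert_injOn hi.le hj e
        have := hp.isPath.getVert_injOn hi hj.le e'
        omega
  have hI : #I = H.degree u := card_filter_adj_getVert_succ hp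
  have hJ : #J = H.degree v := card_filter_adj_getVert hp
  have := card_union_add_card_inter I J
  have := hp.length_eq
  omega

lemma hasHamiltonianCycleThrough_of_isPath {S : Set V} (hS : S.Pairwise H.Adj)
    {p : H.Walk u v} (hp : p.IsPath) (hu : u ∈ S) (hv : v ∈ S)
    (hout : ∀ w, w ∉ p.support → w ∈ S) (hV : 3 ≤ Fintype.card V) (hF : ∀ e ∈ F, e ∈ p.edges) :
    HasHamiltonianCycleThrough H F := by
  induction hm : Fintype.card V - p.length using Nat.strong_induction_on generalizing v with
  | _ m ih =>
    by_cases hall : ∀ w, w ∈ p.support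
    · have hham : p.IsHamiltonian := hp.isHamiltonian_of_mem hall
      have huv : u ≠ v := by
        rintro rfl
        have := hham.length_eq
        rw [Walk.length_eq_zero_iff.2 (Walk.isPath_iff_nil.1 hp)] at this
        omega
      exact ⟨_, _, isHamiltonianCycle_cons_of_isHamiltonian hham (hS hv hu huv.symm) hV,
        fun e he ↦ by simp [hF e he]⟩
    · push Not at hall
      obtain ⟨w, hw⟩ := hall
      have hvw : H.Adj v w := hS hv (hout w hw) (by rintro rfl; simp at hw)
      have hp' : (p.concat hvw).IsPath := hp.concat hw hvw
      have hlt := hp'.length_lt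
      rw [Walk.length_concat] at hlt
      refine ih (Fintype.card V - (p.length + 1)) (by omega) hp' (hout w hw)
        (fun x hx ↦ hout x fun h ↦ hx ?_) (fun e he ↦ ?_) (by rw [Walk.length_concat])
      · simp [Walk.support_concat, h]
      · simp [Walk.edges_concat, hF e he]

lemma exists_le_degree_add_degree_le {G : SimpleGraph V} (hF : ↑F ⊆ G.edgeSet)
    (hG : ¬ HasHamiltonianCycleThrough G F) (hV : 3 ≤ Fintype.card V) :
    ∃ H : SimpleGraph V, G ≤ H ∧ ¬ HasHamiltonianCycleThrough H F ∧
      ∀ [DecidableRel H.Adj] (u v : V), u ≠ v → ¬ H.Adj u v →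
        H.degree u + H.degree v + 1 ≤ Fintype.card V + #F := by
  obtain ⟨H, hGH, hmax⟩ := Finite.exists_le_maximal
    (p := fun H : SimpleGraph V ↦ ¬ HasHamiltonianCycleThrough H F) hG
  refine ⟨H, hGH, hmax.prop, fun {_} u v hne huv ↦ ?_⟩
  have hsup : HasHamiltonianCycleThrough (H ⊔ edge u v) F := by
    by_contra hcon
    have hle := hmax.le_of_ge hcon le_sup_left
    exact huv (hle (Or.inr (by simp [edge_adj, hne])))
  obtain ⟨p, hp, hpF⟩ :=
    exists_isHamiltonian_of_sup_edge (hF.trans (edgeSet_mono hGH)) hmax.prop huv hsup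
  exact degree_add_degree_le_of_isHamiltonian hp hpF hmax.prop hV

end HamiltonianCyclesThroughEdges

section MotzkinStraus

variable {V : Type*} [Fintype V] {G : SimpleGraph V} [DecidableRel G.Adj] {w : V → ℝ} {r : ℕ}

open Matrix

lemma mul_dotProduct_adjMatrix_mulVec_le_of_card_le (hw : ∀ v, 0 ≤ w v)
    (hr : #{v | w v ≠ 0} ≤ r) :
    r * (w ⬝ᵥ (G.adjMatrix ℝ *ᵥ w)) ≤ (r - 1) * (∑ v, w v) ^ 2 := by
  classical
  have hsq : (∑ v, w v) ^ 2 ≤ r * ∑ v, w v ^ 2 := by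
    have hcs := sq_sum_le_card_mul_sum_sq (s := {v | w v ≠ 0}) (f := w)
    rw [sum_filter_ne_zero, sum_filter_of_ne (by intro x _ h; simpa using h)] at hcs
    exact hcs.trans (by gcongr)
  have hrow (u : V) : (G.adjMatrix ℝ *ᵥ w) u + w u ≤ ∑ v, w v := by
    rw [adjMatrix_mulVec_apply, ← sum_erase_add univ w (mem_univ u)]
    have hsub : G.neighborFinset u ⊆ univ.erase u := fun v hv ↦
      mem_erase.2 ⟨((G.mem_neighborFinset u v).1 hv).ne', mem_univ v⟩
    exact add_le_add_left (sum_le_sum_of_subset_of_nonneg hsub fun v _ _ ↦ hw v) _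
  have hform : w ⬝ᵥ (G.adjMatrix ℝ *ᵥ w) + ∑ v, w v ^ 2 ≤ (∑ v, w v) ^ 2 := by
    rw [dotProduct, ← sum_add_distrib, sq, sum_mul]
    refine sum_le_sum fun u _ ↦ ?_
    rw [sq, ← mul_add]
    exact mul_le_mul_of_nonneg_left (hrow u) (hw u)
  nlinarith [r.cast_nonneg (α := ℝ)]

lemma dotProduct_adjMatrix_mulVec_add_single_sub_single [DecidableEq V] {u v : V}
    (huv : ¬ G.Adj u v) (w : V → ℝ) (t : ℝ) :
    (w + (Pi.single u t - Pi.single v t)) ⬝ᵥ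
        (G.adjMatrix ℝ *ᵥ (w + (Pi.single u t - Pi.single v t))) =
      w ⬝ᵥ (G.adjMatrix ℝ *ᵥ w) +
        2 * t * ((G.adjMatrix ℝ *ᵥ w) u - (G.adjMatrix ℝ *ᵥ w) v) := by
  set h : V → ℝ := Pi.single u t - Pi.single v t with hh
  have hdot (x : V → ℝ) : h ⬝ᵥ x = t * (x u - x v) := by
    rw [hh, sub_dotProduct, single_dotProduct, single_dotProduct, mul_sub]
  have hsymm : w ⬝ᵥ (G.adjMatrix ℝ *ᵥ h) = h ⬝ᵥ (G.adjMatrix ℝ *ᵥ w) := by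
    rw [dotProduct_mulVec, ← mulVec_transpose, transpose_adjMatrix, dotProduct_comm]
  have hself : h ⬝ᵥ (G.adjMatrix ℝ *ᵥ h) = 0 := by
    have hrow (x : V) : (G.adjMatrix ℝ *ᵥ h) x =
        t * (G.adjMatrix ℝ x u - G.adjMatrix ℝ x v) := by
      rw [mulVec, dotProduct_comm, hdot]
    simp [hdot, hrow, huv, G.adj_comm v u]
  rw [mulVec_add, add_dotProduct, dotProduct_add, dotProduct_add, hsymm, hself, hdot]
  ring

-- Moving all the weight of one of two nonadjacent vertices to the other changes the quadratic form
-- linearly, so one of the two directions does not decrease it.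
lemma exists_card_lt_and_dotProduct_le {u v : V} (hw : ∀ x, 0 ≤ w x)
    (hu : w u ≠ 0) (hv : w v ≠ 0) (hne : u ≠ v) (huv : ¬ G.Adj u v) :
    ∃ w' : V → ℝ, (∀ x, 0 ≤ w' x) ∧ ∑ x, w' x = ∑ x, w x ∧ #{x | w' x ≠ 0} < #{x | w x ≠ 0} ∧
      w ⬝ᵥ (G.adjMatrix ℝ *ᵥ w) ≤ w' ⬝ᵥ (G.adjMatrix ℝ *ᵥ w') := by
  classical
  wlog hle : (G.adjMatrix ℝ *ᵥ w) v ≤ (G.adjMatrix ℝ *ᵥ w) u generalizing u v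
  · exact this hv hu hne.symm (fun h ↦ huv h.symm) (le_of_not_ge hle)
  set w' : V → ℝ := w + (Pi.single u (w v) - Pi.single v (w v)) with hw'
  have hw'u : w' u = w u + w v := by simp [hw', hne]
  have hw'v : w' v = 0 := by simp [hw', hne.symm]
  have hw'x (x : V) (hxu : x ≠ u) (hxv : x ≠ v) : w' x = w x := by simp [hw', hxu, hxv]
  refine ⟨w', fun x ↦ ?_, by simp [hw', sum_add_distrib],
    card_lt_card ⟨fun x hx ↦ ?_, fun hsub ↦ ?_⟩, ?_⟩
  · rcases eq_or_ne x v with rfl | hxv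
    · exact hw'v.ge
    rcases eq_or_ne x u with rfl | hxu
    · exact hw'u ▸ add_nonneg (hw x) (hw v)
    · exact hw'x x hxu hxv ▸ hw x
  · simp only [mem_filter, mem_univ, true_and] at hx ⊢
    rcases eq_or_ne x u with rfl | hxu
    · exact hu
    rcases eq_or_ne x v with rfl | hxv
    · exact hv
    · rwa [← hw'x x hxu hxv]
  · simpa [hw'v] using hsub (mem_filter.2 ⟨mem_univ v, hv⟩)
  · rw [dotProduct_adjMatrix_mulVec_add_single_sub_single huv]
    nlinarith [mul_nonneg (hw v) (sub_nonneg.2 hle)]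

theorem mul_dotProduct_adjMatrix_mulVec_le (hG : G.CliqueFree (r + 1)) (hw : ∀ v, 0 ≤ w v) :
    r * (w ⬝ᵥ (G.adjMatrix ℝ *ᵥ w)) ≤ (r - 1) * (∑ v, w v) ^ 2 := by
  induction hm : #{v | w v ≠ 0} using Nat.strong_induction_on generalizing w with
  | _ m ih =>
    by_cases hcl : G.IsClique ({v | w v ≠ 0} : Finset V)
    · refine mul_dotProduct_adjMatrix_mulVec_le_of_card_le hw ?_
      by_contra! hlt
      exact hG.mono hlt _ ⟨hcl, rfl⟩
    · simp only [isClique_iff, Set.Pairwise, coe_filter, mem_univ, true_and,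
        Set.mem_ofPred_eq] at hcl
      push Not at hcl
      obtain ⟨u, hu, v, hv, hne, huv⟩ := hcl
      obtain ⟨w', hw', hsum, hcard, hle⟩ := exists_card_lt_and_dotProduct_le hw hu hv hne huv
      rw [← hsum]
      exact (mul_le_mul_of_nonneg_left hle r.cast_nonneg).trans (ih _ (hm ▸ hcard) hw' rfl)

lemma mul_card_edgeFinset_sub_sum_degree_le (hG : G.CliqueFree (r + 1)) {x : V → ℝ}
    (hx0 : ∀ v, 0 ≤ x v) (hx1 : ∀ v, x v ≤ 1) :
    r * (2 * #G.edgeFinset - 2 * ∑ v, x v * G.degree v) ≤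
      (r - 1) * (Fintype.card V - ∑ v, x v) ^ 2 := by
  have hMS := mul_dotProduct_adjMatrix_mulVec_le hG (w := 1 - x) fun v ↦ by simpa using hx1 v
  have hdeg : G.adjMatrix ℝ *ᵥ 1 = fun v ↦ (G.degree v : ℝ) := by
    ext v
    simp [adjMatrix_mulVec_apply]
  have hone : (1 : V → ℝ) ⬝ᵥ (G.adjMatrix ℝ *ᵥ 1) = 2 * #G.edgeFinset := by
    rw [hdeg, one_dotProduct]
    exact_mod_cast G.sum_degrees_eq_twice_card_edges
  have hxone : x ⬝ᵥ (G.adjMatrix ℝ *ᵥ 1) = ∑ v, x v * G.degree v := by rw [hdeg, dotProduct]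
  have honex : (1 : V → ℝ) ⬝ᵥ (G.adjMatrix ℝ *ᵥ x) = ∑ v, x v * G.degree v := by
    rw [dotProduct_mulVec, ← mulVec_transpose, transpose_adjMatrix, dotProduct_comm, hxone]
  have hxx : 0 ≤ x ⬝ᵥ (G.adjMatrix ℝ *ᵥ x) := sum_nonneg fun v _ ↦ mul_nonneg (hx0 v) <| by
    rw [adjMatrix_mulVec_apply]
    exact sum_nonneg fun w _ ↦ hx0 w
  have hsum : ∑ v, (1 - x) v = Fintype.card V - ∑ v, x v := by simp
  rw [mulVec_sub, sub_dotProduct, dotProduct_sub, dotProduct_sub, hone, hxone, honex, hsum] at hMS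
  refine (mul_le_mul_of_nonneg_left ?_ r.cast_nonneg).trans hMS
  linarith

lemma two_mul_card_edgeFinset_le_of_degree_le (hr : 2 ≤ r) (hG : G.CliqueFree (r + 1))
    {A : Finset V} {i : ℕ} (hdeg : ∀ v ∈ A, G.degree v ≤ i)
    (hi : (r : ℝ) * i ≤ (r - 1) * Fintype.card V)
    (hA : ((r : ℝ) - 1) * (Fintype.card V - #A) ≤ r * i) :
    2 * ((r : ℝ) - 1) * #G.edgeFinset + r * i ^ 2 ≤ 2 * (r - 1) * Fintype.card V * i := by
  classical
  set n := Fintype.card V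
  have hr1 : (0 : ℝ) < r - 1 := by
    have : (2 : ℝ) ≤ r := by exact_mod_cast hr
    linarith
  obtain ⟨t, ht⟩ : ∃ t : ℝ, (r - 1) * (n - t) = r * i := ⟨n - r * i / (r - 1), by field_simp; ring⟩
  have ht0 : 0 ≤ t := by nlinarith
  have htA : t ≤ #A := by nlinarith
  have hcA : t / #A * #A = t := div_mul_cancel_of_imp fun h ↦ by linarith
  have hc0 : 0 ≤ t / #A := by positivity
  have hc1 : t / #A ≤ 1 := div_le_one_of_le₀ htA (Nat.cast_nonneg _)
  have hweighted := mul_card_edgeFinset_sub_sum_degree_le hG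
    (x := fun v ↦ if v ∈ A then t / #A else 0) (fun v ↦ by split_ifs <;> simp [hc0])
    (fun v ↦ by split_ifs <;> simp [hc1])
  have hsum : ∑ v, (if v ∈ A then t / #A else 0) = t := by
    simp only [sum_ite_mem, univ_inter, sum_const, nsmul_eq_mul]
    rw [mul_comm, hcA]
  have hsumdeg : ∑ v, (if v ∈ A then t / #A else 0) * (G.degree v : ℝ) ≤ t * i := by
    simp only [ite_mul, zero_mul, sum_ite_mem, univ_inter]
    have hle : ∑ v ∈ A, t / #A * (G.degree v : ℝ) ≤ #A • (t / #A * i) :=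
      sum_le_card_nsmul _ _ _ fun v hv ↦ by gcongr; exact hdeg v hv
    rwa [nsmul_eq_mul, ← mul_assoc, mul_comm (#A : ℝ), hcA] at hle
  rw [hsum] at hweighted
  have hr0 : (0 : ℝ) < r := by linarith
  have hle : r * (2 * #G.edgeFinset - 2 * (t * i)) ≤ (r - 1) * (n - t) ^ 2 :=
    (mul_le_mul_of_nonneg_left (by linarith) hr0.le).trans hweighted
  refine le_of_mul_le_mul_left ?_ hr0
  calc (r : ℝ) * (2 * (r - 1) * #G.edgeFinset + r * i ^ 2)
      = (r - 1) * (r * (2 * #G.edgeFinset - 2 * (t * i))) +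
          r * i * (2 * ((r - 1) * t) + r * i) := by ring
    _ ≤ (r - 1) * ((r - 1) * (n - t) ^ 2) + r * i * (2 * ((r - 1) * t) + r * i) := by
        gcongr
    _ = r * (2 * (r - 1) * n * i) := by
        linear_combination ((r - 1) * (n - t) - r * i) * ht

end MotzkinStraus

section EdgeSplitting

variable {V : Type*} {G : SimpleGraph V} [DecidableRel G.Adj]

lemma two_mul_card_edgeFinset_induce (B : Finset V) :
    2 * #(G.induce (B : Set V)).edgeFinset = ∑ v ∈ B, #{w ∈ B | G.Adj v w} := by
  rw [← sum_degrees_eq_twice_card_edges, ← sum_coe_sort B]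
  refine sum_congr rfl fun v _ ↦ ?_
  rw [← card_neighborFinset_eq_degree, neighborFinset_eq_filter, card_filter, card_filter,
    ← sum_coe_sort B]
  exact sum_congr rfl fun w _ ↦ if_congr Iff.rfl rfl rfl

variable [Fintype V] {r : ℕ}

lemma card_edgeFinset_le_turanGraph_of_cliqueFree (hG : G.CliqueFree (r + 1)) :
    #G.edgeFinset ≤ #(turanGraph (Fintype.card V) r).edgeFinset := by
  rw [card_edgeFinset_turanGraph]
  exact hG.card_edgeFinset_le

lemma degree_eq_card_filter_add_card_filter_compl [DecidableEq V] (A : Finset V) (v : V) :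
    G.degree v = #{w ∈ A | G.Adj v w} + #{w ∈ Aᶜ | G.Adj v w} := by
  simp only [← card_neighborFinset_eq_degree, neighborFinset_eq_filter, card_filter,
    sum_add_sum_compl]

lemma two_mul_card_edgeFinset_eq [DecidableEq V] (A : Finset V) :
    2 * #G.edgeFinset = 2 * #(G.induce ((Aᶜ : Finset V) : Set V)).edgeFinset +
      ∑ v ∈ A, (G.degree v + #{w ∈ Aᶜ | G.Adj v w}) := by
  have hcross : ∑ v ∈ Aᶜ, #{w ∈ A | G.Adj v w} = ∑ v ∈ A, #{w ∈ Aᶜ | G.Adj v w} := by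
    simp only [card_filter]
    rw [sum_comm]
    simp only [G.adj_comm]
  have hcompl : ∑ v ∈ Aᶜ, G.degree v =
      ∑ v ∈ A, #{w ∈ Aᶜ | G.Adj v w} + 2 * #(G.induce ((Aᶜ : Finset V) : Set V)).edgeFinset := by
    rw [two_mul_card_edgeFinset_induce, ← hcross, ← sum_add_distrib]
    exact sum_congr rfl fun v _ ↦ degree_eq_card_filter_add_card_filter_compl A v
  rw [← sum_degrees_eq_twice_card_edges, ← sum_add_sum_compl A, hcompl, sum_add_distrib]
  ring

lemma card_edgeFinset_induce_compl_le [DecidableEq V] {A : Finset V}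
    (hG : (G.induce ((Aᶜ : Finset V) : Set V)).CliqueFree (r + 1)) :
    #(G.induce ((Aᶜ : Finset V) : Set V)).edgeFinset ≤
      #(turanGraph (Fintype.card V - #A) r).edgeFinset := by
  rw [← card_compl, ← Fintype.card_coe Aᶜ]
  exact card_edgeFinset_le_turanGraph_of_cliqueFree hG

lemma card_edgeFinset_le_turanGraph_add_sum_degree (hG : G.CliqueFree (r + 1)) (A : Finset V) :
    #G.edgeFinset ≤ #(turanGraph (Fintype.card V - #A) r).edgeFinset + ∑ v ∈ A, G.degree v := by
  classical
  have hsplit := two_mul_card_edgeFinset_eq (G := G) A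
  have hrest := card_edgeFinset_induce_compl_le (A := A) (hG.comap (Embedding.induce _).isContained)
  have hcross : ∑ v ∈ A, #{w ∈ Aᶜ | G.Adj v w} ≤ ∑ v ∈ A, G.degree v :=
    sum_le_sum fun v _ ↦ by
      rw [degree_eq_card_filter_add_card_filter_compl A v]
      exact Nat.le_add_left _ _
  rw [sum_add_distrib] at hsplit
  omega

end EdgeSplitting

section DegreeCondition

variable {V : Type*} [Fintype V] {G : SimpleGraph V} {k : ℕ}

lemma exists_card_filter_degree_le_of_ne_top {H : SimpleGraph V} [DecidableRel H.Adj] {m : ℕ}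
    (hH : H ≠ ⊤) (hdeg : ∀ u v, u ≠ v → ¬ H.Adj u v → H.degree u + H.degree v + 1 ≤ m) :
    ∃ i, 2 * i + 1 ≤ m ∧ (∃ u, H.degree u = i) ∧
      i + Fintype.card V ≤ #{v | H.degree v ≤ i} + m ∧
      Fintype.card V ≤ #{v | H.degree v + i + 1 ≤ m} + i := by
  classical
  have hex : ({q : V × V | Hᶜ.Adj q.1 q.2} : Finset (V × V)).Nonempty := by
    obtain ⟨u, v, hne, huv⟩ := ne_top_iff_exists_not_adj.1 hH
    exact ⟨(u, v), by simp [hne, huv]⟩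
  -- Chvátal's choice: a nonadjacent pair `u, v` of largest degree sum, with `deg u ≤ deg v`.
  obtain ⟨⟨u, v⟩, huv, hmax⟩ := exists_max_image _ (fun q ↦ H.degree q.1 + H.degree q.2) hex
  simp only [mem_filter, mem_univ, true_and, Prod.forall] at huv hmax
  wlog hduv : H.degree u ≤ H.degree v generalizing u v
  · exact this v u huv.symm (fun x y h ↦ (hmax x y h).trans (by omega)) (by omega)
  have hsum := hdeg u v huv.1 huv.2
  have hcard (x : V) : #(Hᶜ.neighborFinset x) + H.degree x + 1 = Fintype.card V := by
    have := H.degree_lt_card_verts x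
    rw [card_neighborFinset_eq_degree, degree_compl]
    omega
  refine ⟨H.degree u, by omega, ⟨u, rfl⟩, ?_, ?_⟩
  · have hsub : Hᶜ.neighborFinset v ⊆ ({w | H.degree w ≤ H.degree u} : Finset V) := fun w hw ↦ by
      have := hmax v w ((mem_neighborFinset ..).1 hw)
      simp only [mem_filter, mem_univ, true_and]
      omega
    have := card_le_card hsub
    have := hcard v
    omega
  · have hsub : insert u (Hᶜ.neighborFinset u) ⊆
        ({w | H.degree w + H.degree u + 1 ≤ m} : Finset V) := fun w hw ↦ by
      simp only [mem_filter, mem_univ, true_and]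
      obtain rfl | hw := mem_insert.1 hw
      · omega
      · have := hmax u w ((mem_neighborFinset ..).1 hw)
        omega
    have hle := card_le_card hsub
    rw [card_insert_of_notMem (by simp)] at hle
    have := hcard u
    omega

variable [DecidableEq V]

lemma exists_closure_of_not_isPathHamiltonian (hG : ¬ G.IsPathHamiltonian k)
    (hV : 3 ≤ Fintype.card V) :
    ∃ (a b : V) (p : G.Walk a b) (H : SimpleGraph V), p.IsPath ∧ p.length ≤ k ∧ G ≤ H ∧
      ¬ HasHamiltonianCycleThrough H p.edges.toFinset ∧
      ∀ [DecidableRel H.Adj] (u v : V), u ≠ v → ¬ H.Adj u v →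
        H.degree u + H.degree v + 1 ≤ Fintype.card V + k := by
  rw [IsPathHamiltonian] at hG
  push Not at hG
  obtain ⟨a, b, p, hp, hpk, hno⟩ := hG
  have hnot : ¬ HasHamiltonianCycleThrough G p.edges.toFinset := by
    rintro ⟨x, c, hc, hcF⟩
    refine hno x c hc ⟨fun v _ ↦ c.mem_verts_toSubgraph.2 (hc.mem_support v), fun x y h ↦ ?_⟩
    rw [← Subgraph.mem_edgeSet, Walk.mem_edges_toSubgraph] at h ⊢
    exact hcF _ (by simpa using h)
  obtain ⟨H, hGH, hH, hdeg⟩ := exists_le_degree_add_degree_le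
    (fun e he ↦ p.edges_subset_edgeSet (by simpa using he)) hnot hV
  refine ⟨a, b, p, H, hp, hpk, hGH, hH, fun {_} u v hne huv ↦ (hdeg u v hne huv).trans ?_⟩
  gcongr
  exact (p.edges.toFinset_card_le.trans_eq p.length_edges).trans hpk

lemma exists_card_filter_degree_le_of_not_isPathHamiltonian [DecidableRel G.Adj]
    (hG : ¬ G.IsPathHamiltonian k) (hV : 3 ≤ Fintype.card V) :
    ∃ i, 2 * i + 1 ≤ Fintype.card V + k ∧ (∃ u, G.degree u ≤ i) ∧
      i ≤ #{v | G.degree v ≤ i} + k ∧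
      Fintype.card V ≤ #{v | G.degree v + i + 1 ≤ Fintype.card V + k} + i := by
  classical
  obtain ⟨a, b, p, H, hp, -, hGH, hH, hdeg⟩ := exists_closure_of_not_isPathHamiltonian hG hV
  have hle (v : V) : G.degree v ≤ H.degree v := degree_le_of_le hGH
  have htop : H ≠ ⊤ := by
    rintro rfl
    exact hH (hasHamiltonianCycleThrough_of_isPath (fun _ _ _ _ h ↦ h) (hp.mapLe hGH)
      (Set.mem_univ _) (Set.mem_univ _) (fun _ _ ↦ Set.mem_univ _) hV (by simp))
  obtain ⟨i, hi, ⟨u, hu⟩, hlow, hhigh⟩ := exists_card_filter_degree_le_of_ne_top htop hdeg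
  refine ⟨i, hi, ⟨u, hu ▸ hle u⟩, ?_, hhigh.trans ?_⟩
  · have := card_le_card (monotone_filter_right univ fun v _ (h : H.degree v ≤ i) ↦ (hle v).trans h)
    omega
  · gcongr with v
    exact hle v

end DegreeCondition

section EdgeBound

variable {V : Type*} [Fintype V] {G : SimpleGraph V} [DecidableRel G.Adj] {k : ℕ}

lemma card_edgeFinset_lt_of_cliqueFree_four (hG : G.CliqueFree 4) {A : Finset V} {s : ℕ}
    (hA : #A = s) (hdeg : ∀ v ∈ A, G.degree v ≤ s + k) (hn : 6 * k + 26 ≤ Fintype.card V)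
    (hs : 2 * s + k + 1 ≤ Fintype.card V) (hs' : 2 * Fintype.card V ≤ 5 * s + 3 * k) :
    #G.edgeFinset < #(turanGraph (Fintype.card V - 1) 3).edgeFinset + (k + 1) := by
  have hlow : (3 : ℝ) * (s + k) ≤ 2 * Fintype.card V := by
    exact_mod_cast (by omega : 3 * (s + k) ≤ 2 * Fintype.card V)
  have hhigh : 2 * (Fintype.card V : ℝ) ≤ 5 * s + 3 * k := by exact_mod_cast hs'
  have hle := two_mul_card_edgeFinset_le_of_degree_le (r := 3) (by norm_num) hG hdeg
    (by push_cast; linarith) (by push_cast [hA]; linarith)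
  have hturan := four_mul_mul_lt_card_edgeFinset_turanGraph_three hn
    (i := s + k) (by omega)
  have hle' : 4 * #G.edgeFinset + 3 * (s + k) ^ 2 ≤ 4 * Fintype.card V * (s + k) := by
    exact_mod_cast (by push_cast at hle ⊢; linarith :
      (4 * #G.edgeFinset + 3 * (s + k) ^ 2 : ℝ) ≤ 4 * Fintype.card V * (s + k))
  omega

variable [DecidableEq V] {r : ℕ}

lemma card_edgeFinset_lt_or_exists_degree_le (hr : 3 ≤ r) (hG : G.CliqueFree (r + 1))
    (hk : ¬ G.IsPathHamiltonian k)
    (hn : (if r = 3 then 6 * k + 26 else if r ≤ 7 then 5 * k + 11 else 2 * k + 9) ≤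
      Fintype.card V) :
    #G.edgeFinset < #(turanGraph (Fintype.card V - 1) r).edgeFinset + (k + 1) ∨
      (∃ u, G.degree u ≤ k + 1) ∨
      (r = 4 ∧ Fintype.card V = 5 * k + 11 ∧ 2 * k + 6 ≤ #{v | G.degree v ≤ 3 * k + 5}) := by
  obtain ⟨i, hi, ⟨u, hu⟩, hlow, hhigh⟩ :=
    exists_card_filter_degree_le_of_not_isPathHamiltonian hk (by split_ifs at hn <;> omega)
  by_cases hik : i ≤ k + 1
  · exact .inr (.inl ⟨u, hu.trans hik⟩)
  obtain ⟨s, rfl⟩ : ∃ s, i = s + k := ⟨i - k, by omega⟩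
  obtain ⟨A, hAsub, hA⟩ := exists_subset_card_eq (show s ≤ #{v | G.degree v ≤ s + k} by omega)
  have hdeg : ∀ v ∈ A, G.degree v ≤ s + k := fun v hv ↦ by simpa using hAsub hv
  have hsum : ∑ v ∈ A, G.degree v ≤ s * (s + k) :=
    (sum_le_card_nsmul A _ _ hdeg).trans_eq (by rw [hA, smul_eq_mul])
  have hsplit := card_edgeFinset_le_turanGraph_add_sum_degree hG A
  rw [hA] at hsplit
  rcases hr.eq_or_lt with rfl | hr4
  · rw [if_pos rfl] at hn
    by_cases hsk : 5 * s + 3 * k < 2 * Fintype.card V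
    · have := card_edgeFinset_turanGraph_three_add_mul_lt hn (by omega) hsk
      exact .inl (by omega)
    · exact .inl (card_edgeFinset_lt_of_cliqueFree_four hG hA hdeg hn (by omega) (by omega))
  rw [if_neg hr4.ne'] at hn
  rcases (show 4 ≤ r from hr4).eq_or_lt with rfl | hr5
  · rw [if_pos (by norm_num)] at hn
    by_cases hex : Fintype.card V = 5 * k + 11 ∧ s = 2 * k + 5
    · obtain ⟨hV, rfl⟩ := hex
      refine .inr (.inr ⟨rfl, hV, ?_⟩)
      have hfilter : ∀ v, G.degree v + (2 * k + 5 + k) + 1 ≤ Fintype.card V + k ↔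
          G.degree v ≤ 3 * k + 5 := by omega
      simp only [hfilter] at hhigh
      omega
    · have := card_edgeFinset_turanGraph_four_add_mul_lt hn (by omega) (by omega) hex
      exact .inl (by omega)
  · have := card_edgeFinset_turanGraph_add_mul_lt_of_five_le hr5 hn (by omega : 2 ≤ s) (by omega)
    exact .inl (by omega)

end EdgeBound

section TraceableNeighbourhood

variable {V : Type*} {G : SimpleGraph V} {x y : V}

lemma card_toFinset_support [DecidableEq V] {p : G.Walk x y} (hp : p.IsPath) :
    #p.support.toFinset = p.length + 1 := by
  rw [List.toFinset_card_of_nodup hp.support_nodup, Walk.length_support]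

lemma traceable_induce_iff [DecidableEq V] {S : Set V} :
    (G.induce S).Traceable ↔
      ∃ (a b : V) (q : G.Walk a b), q.IsPath ∧ ∀ x, x ∈ q.support ↔ x ∈ S := by
  constructor
  · rintro ⟨a, b, p, hp⟩
    refine ⟨_, _, p.map (Embedding.induce S).toHom,
      hp.isPath.map (Embedding.induce (G := G) S).injective, fun x ↦ ?_⟩
    rw [Walk.support_map, List.mem_map]
    exact ⟨by rintro ⟨z, -, rfl⟩; exact z.2, fun hx ↦ ⟨⟨x, hx⟩, hp.mem_support _, rfl⟩⟩
  · rintro ⟨a, b, q, hq, hS⟩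
    have hqS : ∀ x ∈ q.support, x ∈ S := fun x ↦ (hS x).1
    have hpath : (q.induce S hqS).IsPath := by
      refine Walk.IsPath.mk' (List.Nodup.of_map Subtype.val ?_)
      rw [Walk.support_induce, List.attachWith_map_subtype_val]
      exact hq.support_nodup
    refine ⟨_, _, q.induce S hqS, hpath.isHamiltonian_of_mem fun x ↦ ?_⟩
    rw [Walk.support_induce]
    simpa using (hS x).2 x.2

lemma countP_edges_lt_countP_support [DecidableEq V] (N : Finset V) (hy : y ∈ N)
    (p : G.Walk x y) :
    p.edges.countP (· ∈ N.sym2) < p.support.countP (· ∈ N) := by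
  induction p with
  | nil => simp [hy]
  | @cons u v w h p ih =>
    have := ih hy
    by_cases hu : u ∈ N <;> by_cases hv : v ∈ N <;>
      simp [hu, hv] <;> omega

lemma forall_mem_support_of_countP_support_le [DecidableEq V] (N : Finset V) (hx : x ∈ N)
    (hy : y ∈ N) (p : G.Walk x y)
    (hp : p.support.countP (· ∈ N) ≤ p.edges.countP (· ∈ N.sym2) + 1) :
    ∀ z ∈ p.support, z ∈ N := by
  induction p with
  | nil => simpa using hx
  | @cons u v w h p ih =>
    have hlt := countP_edges_lt_countP_support N hy p
    by_cases hv : v ∈ N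
    · simp only [Walk.support_cons, Walk.edges_cons, List.countP_cons, hx, hv, mk_mem_sym2_iff,
        and_self, decide_true, if_true] at hp
      exact List.forall_mem_cons.2 ⟨hx, ih hv hy (by omega)⟩
    · simp only [Walk.support_cons, Walk.edges_cons, List.countP_cons, hx, hv, mk_mem_sym2_iff,
        and_false, decide_true, decide_false, if_true, Bool.false_eq_true, if_false] at hp
      omega

-- A Hamiltonian path of `N` contained in `p` uses up all the edges that `p` can have inside `N`.
lemma support_subset_of_edges_subset {N : Finset V} (hx : x ∈ N) (hy : y ∈ N) {p : G.Walk x y}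
    (hp : p.IsPath) {a b : V} {q : G.Walk a b} (hq : q.IsPath)
    (hqN : ∀ w, w ∈ q.support ↔ w ∈ N) (hqp : q.edges ⊆ p.edges) : ∀ z ∈ p.support, z ∈ N := by
  classical
  have hsub : q.edges ⊆ p.edges.filter (· ∈ N.sym2) := fun e he ↦
    List.mem_filter.2 ⟨hqp he, decide_eq_true <| mem_sym2_iff.2 fun t ht ↦
      (hqN t).1 (Walk.mem_support_of_mem_edges he ht)⟩
  refine forall_mem_support_of_countP_support_le N hx hy p ?_
  calc p.support.countP (· ∈ N)
      = #(p.support.filter (· ∈ N)).toFinset := by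
        rw [List.countP_eq_length_filter,
          List.toFinset_card_of_nodup (hp.support_nodup.filter _)]
    _ ≤ #q.support.toFinset := card_le_card fun t ht ↦ by simp_all
    _ = q.edges.length + 1 := by
        rw [card_toFinset_support hq, Walk.length_edges]
    _ ≤ p.edges.countP (· ∈ N.sym2) + 1 := by
        rw [List.countP_eq_length_filter]
        gcongr
        exact (hq.isTrail.edges_nodup.subperm hsub).length_le

variable [Fintype V] [DecidableEq V] [DecidableRel G.Adj] {v : V} {k : ℕ}

lemma card_le_of_isHamiltonianCycle_of_edges_subset {c : G.Walk x x} (hc : c.IsHamiltonianCycle)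
    {a b : V} {q : G.Walk a b} (hq : q.IsPath) (hqv : ∀ w, w ∈ q.support ↔ G.Adj v w)
    (hqc : q.edges ⊆ c.edges) : Fintype.card V ≤ G.degree v + 1 := by
  set N := G.neighborFinset v
  obtain ⟨w, hvw⟩ : ∃ w, s(v, w) ∈ c.edges := by
    have hnil := (hc.rotate (hc.mem_support v)).isCycle.not_nil
    exact ⟨_, (c.rotate_edges v _).mem_iff.1 (Walk.mk_start_snd_mem_edges hnil)⟩
  obtain ⟨p, hp, hperm⟩ := exists_isHamiltonian_of_mem_edges hc hvw
  cases p with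
  | nil => exact absurd rfl (c.adj_of_mem_edges hvw).ne
  | @cons _ z _ h p =>
    have hqp : q.edges ⊆ p.edges := fun e he ↦ by
      have hve : v ∉ e := fun hv ↦ G.irrefl ((hqv v).1 (Walk.mem_support_of_mem_edges he hv))
      have hec := hperm.mem_iff.1 (hqc he)
      simp only [Walk.edges_cons, List.mem_cons] at hec
      obtain rfl | rfl | hec := hec
      · simp at hve
      · simp at hve
      · exact hec
    have hsupp := support_subset_of_edges_subset ((mem_neighborFinset ..).2 h)
      ((mem_neighborFinset ..).2 (c.adj_of_mem_edges hvw)) hp.isPath.of_cons hq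
      (fun w ↦ by rw [hqv, mem_neighborFinset]) hqp
    have huniv : (univ : Finset V) ⊆ insert v N := fun t _ ↦ by
      obtain rfl | ht := List.mem_cons.1 (hp.mem_support t)
      · exact mem_insert_self ..
      · exact mem_insert_of_mem (hsupp t ht)
    exact (card_le_card huniv).trans (card_insert_le ..)

lemma not_isPathHamiltonian_of_traceable (hdeg : G.degree v = k + 1)
    (hT : (G.induce (G.neighborSet v)).Traceable) (hV : k + 2 < Fintype.card V) :
    ¬ G.IsPathHamiltonian k := by
  intro hPH
  obtain ⟨a, b, q, hq, hqv⟩ := traceable_induce_iff.1 hT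
  have hlen : q.length + 1 = G.degree v := by
    rw [← card_toFinset_support hq, ← card_neighborFinset_eq_degree]
    congr 1
    ext w
    simp [hqv]
  obtain ⟨x, c, hc, hqc⟩ := hPH a b q hq (by omega)
  have hedges : q.edges ⊆ c.edges := fun e he ↦ by
    rw [← Walk.mem_edges_toSubgraph] at he ⊢
    exact Subgraph.edgeSet_mono hqc he
  have := card_le_of_isHamiltonianCycle_of_edges_subset hc hq hqv hedges
  omega

variable {H : SimpleGraph V} {F : Finset (Sym2 V)} {u a b w : V} {N : Finset V}

lemma hasHamiltonianCycleThrough_of_adj_end (hH : ({u}ᶜ : Set V).Pairwise H.Adj)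
    {q : H.Walk a u} (hq : q.IsPath) (hau : a ≠ u) (huw : H.Adj u w) (hw : w ∉ q.support)
    (hF : ∀ e ∈ F, e ∈ q.edges) (hV : 3 ≤ Fintype.card V) : HasHamiltonianCycleThrough H F := by
  refine hasHamiltonianCycleThrough_of_isPath hH (hq.concat hw huw) hau huw.ne' ?_ hV
    fun e he ↦ by simp [Walk.edges_concat, hF e he]
  rintro x hx rfl
  simp [Walk.support_concat] at hx

lemma hasHamiltonianCycleThrough_of_adj_of_adj (hH : ({u}ᶜ : Set V).Pairwise H.Adj)
    {q : H.Walk a b} (hq : q.IsPath) (hu : u ∉ q.support) (hub : H.Adj u b) (huw : H.Adj u w)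
    (hw : w ∉ q.support) (hF : ∀ e ∈ F, e ∈ q.edges) (hV : 3 ≤ Fintype.card V) :
    HasHamiltonianCycleThrough H F := by
  refine hasHamiltonianCycleThrough_of_adj_end hH (hq.concat hu hub.symm) ?_ huw ?_
    (fun e he ↦ by simp [Walk.edges_concat, hF e he]) hV
  · rintro rfl
    simp at hu
  · simpa [Walk.support_concat, hw] using huw.ne'

lemma hasHamiltonianCycleThrough_of_length_lt (hH : ({u}ᶜ : Set V).Pairwise H.Adj)
    (hN : ∀ w ∈ N, H.Adj u w) {q : H.Walk a u} (hq : q.IsPath) (hlen : q.length < #N)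
    (hN1 : 1 < #N) (hF : ∀ e ∈ F, e ∈ q.edges) (hV : 3 ≤ Fintype.card V) :
    HasHamiltonianCycleThrough H F := by
  rcases eq_or_ne a u with rfl | hau
  · obtain ⟨w, hw, w', hw', hne⟩ := one_lt_card.1 hN1
    obtain rfl := Walk.eq_nil_iff_nil.2 (Walk.isPath_iff_nil.1 hq)
    exact hasHamiltonianCycleThrough_of_adj_end hH (q := .cons (hN w hw).symm .nil)
      (by simpa using (hN w hw).ne') (hN w hw).ne' (hN w' hw')
      (by simpa using ⟨hne.symm, (hN w' hw').ne'⟩) (fun e he ↦ by simpa using hF e he) hV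
  · obtain ⟨w, hw, hwq⟩ : ∃ w ∈ N, w ∉ q.support := by
      by_contra! hcon
      have hsub : insert u N ⊆ q.support.toFinset := insert_subset (by simp) fun z hz ↦ by
        simpa using hcon z hz
      have := card_le_card hsub
      rw [card_insert_of_notMem fun h ↦ (hN u h).ne rfl, card_toFinset_support hq] at this
      omega
    exact hasHamiltonianCycleThrough_of_adj_end hH hq hau (hN w hw) hwq hF hV

lemma hasHamiltonianCycleThrough_of_mem_support (hH : ({u}ᶜ : Set V).Pairwise H.Adj)
    (hN : ∀ w ∈ N, H.Adj u w) {q : H.Walk a b} (hq : q.IsPath) (hlen : q.length < #N)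
    (hN1 : 1 < #N) (hu : u ∈ q.support) (hF : ∀ e ∈ F, e ∈ q.edges) (hV : 3 ≤ Fintype.card V) :
    HasHamiltonianCycleThrough H F := by
  rcases eq_or_ne b u with rfl | hb
  · exact hasHamiltonianCycleThrough_of_length_lt hH hN hq hlen hN1 hF hV
  rcases eq_or_ne a u with rfl | ha
  · exact hasHamiltonianCycleThrough_of_length_lt hH hN hq.reverse (by simpa using hlen) hN1
      (by simpa using hF) hV
  · exact hasHamiltonianCycleThrough_of_isPath hH hq ha hb (by rintro x hx rfl; exact hx hu) hV hF

lemma hasHamiltonianCycleThrough_of_notMem_support (hH : ({u}ᶜ : Set V).Pairwise H.Adj)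
    (hN : ∀ w ∈ N, H.Adj u w) {q : H.Walk a b} (hq : q.IsPath) (hlen : q.length < #N)
    (hN1 : 1 < #N) (hu : u ∉ q.support) (hw : w ∈ N) (hwq : w ∉ q.support)
    (hF : ∀ e ∈ F, e ∈ q.edges) (hV : 3 ≤ Fintype.card V) : HasHamiltonianCycleThrough H F := by
  by_cases hb : b ∈ N
  · exact hasHamiltonianCycleThrough_of_adj_of_adj hH hq hu (hN b hb) (hN w hw) hwq hF hV
  by_cases ha : a ∈ N
  · exact hasHamiltonianCycleThrough_of_adj_of_adj hH hq.reverse (by simpa using hu) (hN a ha)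
      (hN w hw) (by simpa using hwq) (by simpa using hF) hV
  obtain ⟨w', hw', hww', hw'q⟩ : ∃ w' ∈ N, w' ≠ w ∧ w' ∉ q.support := by
    by_contra! hcon
    have hsub : N.erase w ⊆ q.support.toFinset \ {a, b} := fun z hz ↦ by
      obtain ⟨hzw, hz⟩ := mem_erase.1 hz
      have hza : z ≠ a := fun h ↦ ha (h ▸ hz)
      have hzb : z ≠ b := fun h ↦ hb (h ▸ hz)
      simp [hcon z hz hzw, hza, hzb]
    have hle := card_le_card hsub
    rw [card_erase_of_mem hw, card_sdiff_of_subset (by simp [insert_subset_iff]),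
      card_toFinset_support hq] at hle
    rcases eq_or_ne a b with rfl | hab
    · have := Walk.length_eq_zero_iff.2 (Walk.isPath_iff_nil.1 hq)
      simp at hle
      omega
    · rw [card_pair hab] at hle
      omega
  have hbw' : H.Adj b w' := hH (by rintro rfl; simp at hu) (hN w' hw').ne'
    (by rintro rfl; simp at hw'q)
  exact hasHamiltonianCycleThrough_of_adj_of_adj hH (hq.concat hw'q hbw')
    (by simpa [Walk.support_concat, hu] using (hN w' hw').ne) (hN w' hw') (hN w hw)
    (by simpa [Walk.support_concat, hwq] using hww'.symm)
    (fun e he ↦ by simp [Walk.edges_concat, hF e he]) hV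

lemma traceable_induce_neighborSet (hGH : G ≤ H) (hdeg : G.degree u = k + 1)
    (hH : ({u}ᶜ : Set V).Pairwise H.Adj) {p : G.Walk a b} (hp : p.IsPath) (hlen : p.length ≤ k)
    (hp' : ¬ HasHamiltonianCycleThrough H p.edges.toFinset) (hV : 3 ≤ Fintype.card V) :
    (G.induce (G.neighborSet u)).Traceable := by
  rw [traceable_induce_iff]
  rw [← card_neighborFinset_eq_degree] at hdeg
  rcases k.eq_zero_or_pos with rfl | hk
  · obtain ⟨w, hw⟩ := card_eq_one.1 hdeg
    exact ⟨w, w, .nil, .nil, fun x ↦ by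
      rw [mem_neighborSet, ← mem_neighborFinset, hw, Walk.mem_support_nil_iff, mem_singleton]⟩
  · have hN : ∀ w ∈ G.neighborFinset u, H.Adj u w := fun w hw ↦ hGH ((mem_neighborFinset ..).1 hw)
    have hpH : (p.mapLe hGH).IsPath := hp.mapLe hGH
    have hlenH : (p.mapLe hGH).length < #(G.neighborFinset u) := by
      rw [Walk.length_map, hdeg]
      omega
    have hu : u ∉ (p.mapLe hGH).support := fun hu ↦ hp' <|
      hasHamiltonianCycleThrough_of_mem_support hH hN hpH hlenH (by omega) hu (by simp) hV
    have hsub : G.neighborFinset u ⊆ p.support.toFinset := fun w hw ↦ by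
      by_contra hwp
      exact hp' <| hasHamiltonianCycleThrough_of_notMem_support hH hN hpH hlenH (by omega) hu hw
        (by simpa using hwp) (by simp) hV
    have heq := eq_of_subset_of_card_le hsub (by rw [card_toFinset_support hp]; omega)
    exact ⟨a, b, p, hp, fun x ↦ by
      rw [← List.mem_toFinset, ← heq, mem_neighborFinset, mem_neighborSet]⟩

end TraceableNeighbourhood

section TuranPlusVertex

lemma nonempty_iso_turanGraph_of_card_eq {W : Type*} [Fintype W] {G : SimpleGraph W}
    [DecidableRel G.Adj] {r m : ℕ} (hr : 0 < r) (hG : G.CliqueFree (r + 1))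
    (hm : Fintype.card W = m) (h : #G.edgeFinset = #(turanGraph m r).edgeFinset) :
    Nonempty (G ≃g turanGraph m r) := by
  subst hm
  rw [← isTuranMaximal_iff_nonempty_iso_turanGraph hr]
  exact ⟨hG, fun G' _ hG' ↦ h ▸ card_edgeFinset_le_turanGraph_of_cliqueFree hG'⟩

variable {V : Type*} [Fintype V] {G : SimpleGraph V} [DecidableRel G.Adj] {n r k : ℕ} {u x : V}

lemma card_le_degree_add_of_card_edgeFinset_eq (hr : 0 < r) (hG : G.CliqueFree (r + 1))
    (hu : G.degree u ≤ k + 1)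
    (he : #G.edgeFinset = #(turanGraph (Fintype.card V - 1) r).edgeFinset + (k + 1))
    (hx : x ≠ u) : Fintype.card V ≤ G.degree x + 2 + (Fintype.card V - 2) / r := by
  classical
  have hcard : 2 ≤ Fintype.card V := by
    rw [← card_pair hx]
    exact card_le_univ _
  have hedges := card_edgeFinset_le_turanGraph_add_sum_degree hG {u, x}
  rw [card_pair hx.symm, sum_pair hx.symm, he] at hedges
  have hsucc := card_edgeFinset_turanGraph_succ hr (Fintype.card V - 2)
  rw [show Fintype.card V - 2 + 1 = Fintype.card V - 1 by omega] at hsucc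
  omega

variable [DecidableEq V]

lemma card_edgeFinset_eq_induce_compl_singleton_add (v : V) :
    #G.edgeFinset = #(G.induce ({v}ᶜ : Set V)).edgeFinset + G.degree v := by
  rw [card_edgeFinset_induce_compl_singleton, G.card_edgeFinset_deleteIncidenceSet v,
    Nat.sub_add_cancel]
  rw [← card_incidenceFinset_eq_degree]
  exact card_le_card (G.incidenceFinset_subset v)

lemma not_isPathHamiltonian_and_card_edgeFinset_eq (h : G.IsTuranPlusTraceableVertex n r k)
    (hn : k + 2 < n) :
    ¬ G.IsPathHamiltonian k ∧
      #G.edgeFinset = #(turanGraph (n - 1) r).edgeFinset + (k + 1) := by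
  obtain ⟨rfl, -, v, ⟨φ⟩, hdeg, hT⟩ := h
  refine ⟨not_isPathHamiltonian_of_traceable hdeg hT hn, ?_⟩
  rw [card_edgeFinset_eq_induce_compl_singleton_add v, hdeg, φ.card_edgeFinset_eq]

lemma isTuranPlusTraceableVertex_of_degree_le (hr : 0 < r) (hG : G.CliqueFree (r + 1))
    (hk : ¬ G.IsPathHamiltonian k) (hn : k + 3 + 2 * ((Fintype.card V - 2) / r) < Fintype.card V)
    (he : #G.edgeFinset = #(turanGraph (Fintype.card V - 1) r).edgeFinset + (k + 1))
    (hu : G.degree u ≤ k + 1) : G.IsTuranPlusTraceableVertex (Fintype.card V) r k := by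
  classical
  have hfree := hG.comap (Embedding.induce (G := G) ({u}ᶜ : Set V)).isContained
  have hcard : Fintype.card ({u}ᶜ : Set V) = Fintype.card V - 1 := by
    rw [Fintype.card_compl_set, Set.card_singleton]
  have hsplit := card_edgeFinset_eq_induce_compl_singleton_add (G := G) u
  have hrest := card_edgeFinset_le_turanGraph_of_cliqueFree hfree
  rw [hcard] at hrest
  have hdeg : G.degree u = k + 1 := by omega
  refine ⟨rfl, hG, u, nonempty_iso_turanGraph_of_card_eq hr hfree hcard (by omega), hdeg, ?_⟩
  obtain ⟨a, b, p, H, hp, hlen, hGH, hH, hsum⟩ :=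
    exists_closure_of_not_isPathHamiltonian hk (by omega)
  refine traceable_induce_neighborSet hGH hdeg (fun x hx y hy hxy ↦ ?_) hp hlen hH (by omega)
  by_contra hadj
  have hx := card_le_degree_add_of_card_edgeFinset_eq hr hG hu he hx
  have hy := card_le_degree_add_of_card_edgeFinset_eq hr hG hu he hy
  have hxH : G.degree x ≤ H.degree x := degree_le_of_le hGH
  have hyH : G.degree y ≤ H.degree y := degree_le_of_le hGH
  have := hsum x y hxy hadj
  omega

end TuranPlusVertex

section ExceptionalGraph

variable {V : Type*} {G : SimpleGraph V} {r k : ℕ} {A : Finset V}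

lemma cliqueFree_induce_of_forall_adj {B : Set V} {a : V} (hG : G.CliqueFree (r + 1))
    (ha : ∀ w ∈ B, G.Adj a w) : (G.induce B).CliqueFree r := by
  classical
  rw [cliqueFree_induce_iff]
  intro t ht htr
  exact hG _ (htr.insert fun w hw ↦ ha w (ht hw))

lemma nonempty_iso_completeMultipartiteGraph [Fintype V] {ι : Type*} [DecidableEq ι] {m : ι → ℕ}
    (part : V → ι) (hadj : ∀ x y, G.Adj x y ↔ part x ≠ part y)
    (hm : ∀ i, Fintype.card {v // part v = i} = m i) :
    Nonempty (G ≃g completeMultipartiteGraph fun i ↦ Fin (m i)) :=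
  ⟨⟨(Equiv.sigmaFiberEquiv part).symm.trans
    (Equiv.sigmaCongrRight fun i ↦ Fintype.equivFinOfCardEq (hm i)), (hadj _ _).symm⟩⟩

variable [DecidableEq V]

lemma two_mul_card_le_of_isHamiltonianCycle [Fintype V] {a : V} {c : G.Walk a a}
    (hc : c.IsHamiltonianCycle) (hA : G.IsIndepSet A) : 2 * #A ≤ Fintype.card V := by
  have hsucc : #A ≤ #{i ∈ range c.length | c.getVert (i + 1) ∈ A} := by
    refine (card_le_card fun x hx ↦ ?_).trans (card_image_le (f := fun i ↦ c.getVert (i + 1)))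
    obtain ⟨i, hi, hil⟩ :=
      Walk.mem_support_iff_exists_getVert.1 (hc.isHamiltonian_tail.mem_support x)
    rw [Walk.getVert_tail] at hi
    have := Walk.length_tail_add_one hc.isCycle.not_nil
    exact mem_image.2 ⟨i, mem_filter.2 ⟨mem_range.2 (by omega), hi ▸ hx⟩, hi⟩
  have hpred : #{i ∈ range c.length | c.getVert (i + 1) ∈ A} ≤ #Aᶜ := by
    refine card_le_card_of_injOn c.getVert (fun i hi ↦ ?_) fun i hi j hj hij ↦ ?_
    · obtain ⟨hi, hiA⟩ := mem_filter.1 hi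
      have hadj := c.adj_getVert_succ (mem_range.1 hi)
      exact mem_compl.2 fun h ↦ hA h hiA hadj.ne hadj
    · have hi := mem_range.1 (mem_filter.1 hi).1
      have hj := mem_range.1 (mem_filter.1 hj).1
      exact hc.isCycle.getVert_injOn' (show i ≤ c.length - 1 by omega)
        (show j ≤ c.length - 1 by omega) hij
  rw [card_compl] at hpred
  have := card_le_univ A
  omega

lemma card_edgeFinset_K6221 : #K6221.edgeFinset = 38 := by
  decide +kernel

lemma not_isPathHamiltonian_of_iso_K6221 (φ : G ≃g K6221) : ¬ G.IsPathHamiltonian 0 := by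
  intro hPH
  have := Fintype.ofEquiv _ φ.symm.toEquiv
  obtain ⟨a, c, hc, -⟩ := hPH (φ.symm ⟨0, (0 : Fin 6)⟩) _ .nil .nil (by simp)
  have hcard := two_mul_card_le_of_isHamiltonianCycle hc
    (A := univ.image (φ.symm ∘ Sigma.mk (0 : Fin 4))) fun x hx y hy _ ↦ by
      obtain ⟨i, -, rfl⟩ := mem_image.1 hx
      obtain ⟨j, -, rfl⟩ := mem_image.1 hy
      rw [Function.comp_apply, Function.comp_apply, φ.symm.map_adj_iff]
      simp
  rw [card_image_of_injective univ (φ.symm.injective.comp sigma_mk_injective), card_univ,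
    φ.card_eq] at hcard
  revert hcard
  decide

variable [Fintype V]

lemma nonempty_iso_K6221_of_adj_iff (hA : #A = 6) (hadj : ∀ v ∈ A, ∀ w, G.Adj v w ↔ w ∉ A)
    (ψ : G.induce ((Aᶜ : Finset V) : Set V) ≃g turanGraph 5 3) : Nonempty (G ≃g K6221) := by
  let part : Fin 6 ⊕ Fin 5 → Fin 4 := Sum.elim (fun _ ↦ 0) ![1, 2, 3, 1, 2]
  let e : V ≃ Fin 6 ⊕ Fin 5 := (Equiv.sumCompl (· ∈ A)).symm.trans <|
    Equiv.sumCongr (A.equivFinOfCardEq hA)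
      ((Equiv.subtypeEquivRight fun _ ↦ by simp).trans ψ.toEquiv)
  have hmem (v : V) (hv : v ∈ A) : part (e v) = 0 := by
    simp [part, e, Equiv.sumCompl_symm_apply_of_pos, hv]
  have hnotMem (v : V) (hv : v ∉ A) :
      part (e v) = ![1, 2, 3, 1, 2] (ψ ⟨v, by simpa using hv⟩) := by
    simp only [part, e, Equiv.trans_apply, Equiv.sumCompl_symm_apply_of_neg hv]
    rfl
  have hpos : ∀ i : Fin 5, (![1, 2, 3, 1, 2] i : Fin 4) ≠ 0 := by decide
  have hmod : ∀ i j : Fin 5,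
      (turanGraph 5 3).Adj i j ↔ (![1, 2, 3, 1, 2] i : Fin 4) ≠ ![1, 2, 3, 1, 2] j := by decide
  refine nonempty_iso_completeMultipartiteGraph (part ∘ e) (fun x y ↦ ?_) fun i ↦ ?_
  · rw [Function.comp_apply, Function.comp_apply]
    by_cases hx : x ∈ A
    · by_cases hy : y ∈ A
      · simp [hadj x hx, hmem, hx, hy]
      · simp [hadj x hx, hmem x hx, hnotMem y hy, hy, (hpos _).symm]
    · by_cases hy : y ∈ A
      · simp [G.adj_comm x y, hadj y hy, hmem y hy, hnotMem x hx, hx, hpos]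
      · rw [hnotMem x hx, hnotMem y hy, ← hmod, ψ.map_adj_iff]
        rfl
  · rw [Fintype.card_congr (e.subtypeEquiv (p := fun v ↦ (part ∘ e) v = i)
      (q := fun z ↦ part z = i) fun _ ↦ Iff.rfl)]
    revert i
    decide

variable [DecidableRel G.Adj]

lemma card_edgeFinset_le_turanGraph_add_mul (hA : ∀ v ∈ A, G.degree v ≤ #Aᶜ)
    (hG : (G.induce ((Aᶜ : Finset V) : Set V)).CliqueFree (r + 1)) :
    #G.edgeFinset ≤ #(turanGraph #Aᶜ r).edgeFinset + #A * #Aᶜ := by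
  have hsplit := two_mul_card_edgeFinset_eq (G := G) A
  have hrest := card_edgeFinset_induce_compl_le hG
  have hsum := sum_le_card_nsmul A _ (2 * #Aᶜ) fun v hv ↦
    (add_le_add (hA v hv) (card_filter_le Aᶜ (G.Adj v))).trans_eq (two_mul _).symm
  rw [← card_compl] at hrest
  rw [smul_eq_mul] at hsum
  linarith

lemma nonempty_iso_turanGraph_and_adj_iff (hr : 0 < r) (hA : ∀ v ∈ A, G.degree v ≤ #Aᶜ)
    (hG : (G.induce ((Aᶜ : Finset V) : Set V)).CliqueFree (r + 1))
    (he : #G.edgeFinset = #(turanGraph #Aᶜ r).edgeFinset + #A * #Aᶜ) :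
    Nonempty (G.induce ((Aᶜ : Finset V) : Set V) ≃g turanGraph #Aᶜ r) ∧
      ∀ v ∈ A, ∀ w, G.Adj v w ↔ w ∉ A := by
  have hsplit := two_mul_card_edgeFinset_eq (G := G) A
  have hrest := card_edgeFinset_induce_compl_le hG
  rw [← card_compl] at hrest
  have hle (v : V) (hv : v ∈ A) : G.degree v + #{w ∈ Aᶜ | G.Adj v w} ≤ 2 * #Aᶜ :=
    (add_le_add (hA v hv) (card_filter_le Aᶜ (G.Adj v))).trans_eq (two_mul _).symm
  have hsum := sum_le_card_nsmul A _ _ hle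
  rw [smul_eq_mul] at hsum
  refine ⟨nonempty_iso_turanGraph_of_card_eq hr hG (Fintype.card_coe _) (by linarith), ?_⟩
  have heq := (sum_eq_sum_iff_of_le hle).1 (by rw [sum_const, smul_eq_mul]; linarith)
  intro v hv w
  have := card_filter_le Aᶜ (G.Adj v)
  have hdeg := hA v hv
  have htot := heq v hv
  have hinside := degree_eq_card_filter_add_card_filter_compl (G := G) A v
  have hA0 : #{w ∈ A | G.Adj v w} = 0 := by omega
  refine ⟨fun h hw ↦ filter_eq_empty_iff.1 (card_eq_zero.1 hA0) hw h, fun hw ↦ ?_⟩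
  exact filter_card_eq (show #{w ∈ Aᶜ | G.Adj v w} = #Aᶜ by omega) w (mem_compl.2 hw)

lemma card_edgeFinset_lt_or_iso_K6221_of_cliqueFree_four (hV : Fintype.card V = 5 * k + 11)
    (hA : #A = 2 * k + 6) (hdeg : ∀ v ∈ A, G.degree v ≤ 3 * k + 5)
    (hG : (G.induce ((Aᶜ : Finset V) : Set V)).CliqueFree 4) :
    #G.edgeFinset < #(turanGraph (5 * k + 10) 4).edgeFinset + (k + 1) ∨
      #G.edgeFinset = #(turanGraph (5 * k + 10) 4).edgeFinset + (k + 1) ∧ k = 0 ∧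
        Nonempty (G ≃g K6221) := by
  have hcompl : #Aᶜ = 3 * k + 5 := by rw [card_compl]; omega
  have hdeg' : ∀ v ∈ A, G.degree v ≤ #Aᶜ := by rwa [hcompl]
  have hedges := card_edgeFinset_le_turanGraph_add_mul (r := 3) hdeg' hG
  rw [hA, hcompl] at hedges
  rcases k.eq_zero_or_pos with rfl | hk
  · have h53 : #(turanGraph 5 3).edgeFinset = 8 := by rw [card_edgeFinset_turanGraph]; rfl
    have h104 : #(turanGraph 10 4).edgeFinset = 37 := by rw [card_edgeFinset_turanGraph]; rfl
    rw [mul_zero, mul_zero, zero_add, zero_add, h53] at hedges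
    rw [mul_zero, zero_add, h104]
    refine hedges.lt_or_eq.imp id fun he ↦ ⟨he, rfl, ?_⟩
    obtain ⟨⟨ψ⟩, hadj⟩ := nonempty_iso_turanGraph_and_adj_iff three_pos hdeg' hG
      (by rw [hA, hcompl, mul_zero, mul_zero, zero_add, zero_add, h53, he])
    rw [hcompl] at ψ
    exact nonempty_iso_K6221_of_adj_iff hA hadj ψ
  · left
    have hupper := mul_card_edgeFinset_turanGraph_le (n := 3 * k + 5) (r := 3)
    have hlower := mul_sq_le_card_edgeFinset_turanGraph four_pos (5 * k + 10)
    zify at *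
    nlinarith

end ExceptionalGraph

section ExtremalGraphs

variable {V : Type*} [Fintype V] {G : SimpleGraph V} [DecidableRel G.Adj] {r k : ℕ}

lemma card_edgeFinset_lt_of_forall_exists_not_adj {A : Finset V} (hG : G.CliqueFree 5)
    (hV : Fintype.card V = 5 * k + 11) (hA : #A = 2 * k + 6)
    (hdeg : ∀ v ∈ A, G.degree v ≤ 3 * k + 5) (hadj : ∀ v ∈ A, ∃ w ∉ A, ¬ G.Adj v w) :
    #G.edgeFinset < #(turanGraph (5 * k + 10) 4).edgeFinset + (k + 1) := by
  classical
  have hcompl : #Aᶜ = 3 * k + 5 := by rw [card_compl]; omega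
  have hcross (v : V) (hv : v ∈ A) : G.degree v + #{w ∈ Aᶜ | G.Adj v w} ≤ 6 * k + 9 := by
    have hlt : #{w ∈ Aᶜ | G.Adj v w} < #Aᶜ := by
      obtain ⟨w, hw, hvw⟩ := hadj v hv
      exact card_lt_card (filter_ssubset.2 ⟨w, mem_compl.2 hw, hvw⟩)
    have := hdeg v hv
    omega
  have hsum := sum_le_card_nsmul A _ _ hcross
  have hsplit := two_mul_card_edgeFinset_eq (G := G) A
  have hrest := card_edgeFinset_induce_compl_le (r := 4) (A := A)
    (hG.comap (Embedding.induce _).isContained)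
  have hupper := mul_card_edgeFinset_turanGraph_le (n := 3 * k + 5) (r := 4)
  have hlower := mul_sq_le_card_edgeFinset_turanGraph four_pos (5 * k + 10)
  rw [← card_compl, hcompl] at hrest
  rw [hA, smul_eq_mul] at hsum
  zify at *
  nlinarith

lemma card_edgeFinset_lt_or_iso_K6221 (hG : G.CliqueFree 5) (hV : Fintype.card V = 5 * k + 11)
    (hk : 2 * k + 6 ≤ #{v | G.degree v ≤ 3 * k + 5}) :
    #G.edgeFinset < #(turanGraph (5 * k + 10) 4).edgeFinset + (k + 1) ∨
      #G.edgeFinset = #(turanGraph (5 * k + 10) 4).edgeFinset + (k + 1) ∧ k = 0 ∧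
        Nonempty (G ≃g K6221) := by
  classical
  obtain ⟨A, hAsub, hA⟩ := exists_subset_card_eq hk
  have hdeg : ∀ v ∈ A, G.degree v ≤ 3 * k + 5 := fun v hv ↦ by simpa using hAsub hv
  by_cases hadj : ∀ v ∈ A, ∃ w ∉ A, ¬ G.Adj v w
  · exact Or.inl (card_edgeFinset_lt_of_forall_exists_not_adj hG hV hA hdeg hadj)
  · push Not at hadj
    obtain ⟨a, -, ha⟩ := hadj
    refine card_edgeFinset_lt_or_iso_K6221_of_cliqueFree_four hV hA hdeg ?_
    exact cliqueFree_induce_of_forall_adj hG fun w hw ↦ ha w (by simpa using hw)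

variable [DecidableEq V]

lemma card_edgeFinset_lt_or_eq_and_extremal (hr : 3 ≤ r) (hG : G.CliqueFree (r + 1))
    (hk : ¬ G.IsPathHamiltonian k)
    (hn : (if r = 3 then 6 * k + 26 else if r ≤ 7 then 5 * k + 11 else 2 * k + 9) ≤
      Fintype.card V) :
    #G.edgeFinset < #(turanGraph (Fintype.card V - 1) r).edgeFinset + (k + 1) ∨
      #G.edgeFinset = #(turanGraph (Fintype.card V - 1) r).edgeFinset + (k + 1) ∧
        (G.IsTuranPlusTraceableVertex (Fintype.card V) r k ∨
          Nonempty (G ≃g K6221) ∧ k = 0 ∧ r = 4 ∧ Fintype.card V = 11) := by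
  rcases card_edgeFinset_lt_or_exists_degree_le hr hG hk hn with hlt | ⟨u, hu⟩ | ⟨rfl, hV, hlow⟩
  · exact .inl hlt
  · have hcard : k + 3 + 2 * ((Fintype.card V - 2) / r) < Fintype.card V := by
      rcases hr.eq_or_lt with rfl | hr4
      · rw [if_pos rfl] at hn
        omega
      · have : (Fintype.card V - 2) / r ≤ (Fintype.card V - 2) / 4 :=
          Nat.div_le_div_left hr4 four_pos
        split_ifs at hn <;> omega
    have hsplit := card_edgeFinset_le_turanGraph_add_sum_degree hG {u}
    rw [card_singleton, sum_singleton] at hsplit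
    refine (hsplit.trans (Nat.add_le_add_left hu _)).lt_or_eq.imp id fun he ↦ ⟨he, .inl ?_⟩
    exact isTuranPlusTraceableVertex_of_degree_le (by omega) hG hk hcard he hu
  · rw [hV, show 5 * k + 11 - 1 = 5 * k + 10 by omega]
    refine (card_edgeFinset_lt_or_iso_K6221 hG hV hlow).imp id ?_
    rintro ⟨he, rfl, hiso⟩
    exact ⟨he, .inr ⟨hiso, rfl, rfl, rfl⟩⟩

end ExtremalGraphs

end PathHamiltonian

open PathHamiltonian in
theorem mainTheorem4_general {V : Type*} [Fintype V] [DecidableEq V] (G : SimpleGraph V)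
    [DecidableRel G.Adj] (n r k : ℕ) (hr : 3 ≤ r) (hn : Fintype.card V = n)
    (hG : G.CliqueFree (r + 1))
    (hnk : (if r = 3 then 6 * k + 26 else if r ≤ 7 then 5 * k + 11 else 2 * k + 9) ≤ n) :
    (¬ G.IsPathHamiltonian k →
      G.edgeFinset.card ≤ (SimpleGraph.turanGraph (n - 1) r).edgeFinset.card + (k + 1)) ∧
    ((¬ G.IsPathHamiltonian k ∧
      G.edgeFinset.card = (SimpleGraph.turanGraph (n - 1) r).edgeFinset.card + (k + 1)) ↔
      (G.IsTuranPlusTraceableVertex n r k ∨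
        (Nonempty (G ≃g SimpleGraph.K6221) ∧ k = 0 ∧ r = 4 ∧ n = 11))) := by
  subst hn
  refine ⟨fun hk ↦ ?_, fun ⟨hk, he⟩ ↦ ?_, ?_⟩
  · exact (card_edgeFinset_lt_or_eq_and_extremal hr hG hk hnk).elim le_of_lt fun h ↦ h.1.le
  · exact (card_edgeFinset_lt_or_eq_and_extremal hr hG hk hnk).elim (absurd he ·.ne) And.right
  · rintro (h | ⟨⟨φ⟩, rfl, rfl, hV⟩)
    · exact not_isPathHamiltonian_and_card_edgeFinset_eq h (by split_ifs at hnk <;> omega)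
    · refine ⟨not_isPathHamiltonian_of_iso_K6221 φ, ?_⟩
      rw [φ.card_edgeFinset_eq, card_edgeFinset_K6221, hV, SimpleGraph.card_edgeFinset_turanGraph]
      rfl

theorem mainTheorem4 {V : Type*} [Fintype V] [DecidableEq V] (G : SimpleGraph V)
    [DecidableRel G.Adj] (n r k : ℕ) (hr : 3 ≤ r) (hn : Fintype.card V = n)
    (hG : G.CliqueFree (r + 1)) :
    ((if r = 3 then 6 * k + 26 else if r ≤ 7 then 5 * k + 11 else 2 * k + 9) ≤ n →
      (¬ G.IsPathHamiltonian k →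
        G.edgeFinset.card ≤ (SimpleGraph.turanGraph (n - 1) r).edgeFinset.card + (k + 1)) ∧
      (G.IsTuranPlusTraceableVertex n r k →
        ¬ G.IsPathHamiltonian k ∧
        G.edgeFinset.card = (SimpleGraph.turanGraph (n - 1) r).edgeFinset.card + (k + 1))) ∧
    ((if r = 3 then 6 * k + 26 else if r ≤ 7 then 6 * k + 2 * r + 3 else 2 * k + 2 * r) ≤ n →
      (¬ G.IsPathHamiltonian k →
        G.edgeFinset.card ≤ (SimpleGraph.turanGraph (n - 1) r).edgeFinset.card + (k + 1)) ∧
      ((¬ G.IsPathHamiltonian k ∧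
        G.edgeFinset.card = (SimpleGraph.turanGraph (n - 1) r).edgeFinset.card + (k + 1)) ↔
        (G.IsTuranPlusTraceableVertex n r k ∨
          (Nonempty (G ≃g SimpleGraph.K6221) ∧ k = 0 ∧ r = 4 ∧ n = 11)))) := by
  have general := mainTheorem4_general G n r k hr hn hG
  refine ⟨fun hnk ↦ ?_, fun hnk ↦ general (by split_ifs at hnk ⊢ <;> omega)⟩
  exact ⟨(general hnk).1, fun h ↦ (general hnk).2.2 (.inl h)⟩
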